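/- Let $L$ be any first-order language. $\mathbf{IQC}$ is intuitionistic first-order logic with equality in $L$ (primitives $\bot,=,\wedge,\vee,\supset,\forall,\exists$; natural deduction with *ex falso*, $t=t$, and the rule from $s=t$ and $A(s)$ infer $A(t)$). $\mathbf{EQC}$ is classical first-order $\mathbf{S4}$ with equality: its formulas are built with the additional operator $\Box$; its rules are those of $\mathbf{IQC}$ (for all formulas of this larger language) with *ex falso* replaced by classical reductio, together with: from $\Box A$ infer $A$; and from $A$ infer $\Box A$, provided all open assumptions are of the form $\Box B$. $\mathbf{HA}$ (resp. $\mathbf{EA}$) is $\mathbf{IQC}$ (resp. $\mathbf{EQC}$) in the language $0,s,+,\cdot$ with the axioms $\neg\, s(x)=0$, $s(x)=s(y)\supset x=y$, the defining equations of $+$ and $\cdot$, and induction for all formulas (resp. for all formulas including those with $\Box$). For a $\Box$-free formula $A$ define the modified Rasiowa–Sikorski translation $A^{\Box_{\mathbf{RS}}}$ by: $\bot$ and $s=t$ are unchanged; $P\mapsto\Box P$ for other atomic $P$; and, writing $A'$ for $A^{\Box_{\mathbf{RS}}}$, $(A\vee B)'=\Box A'\vee\Box B'$, $(A\wedge B)'=A'\wedge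 B'$, $(A\supset B)'=\Box(\Box A'\supset\Box B')$, $(\exists x A)'=\exists x\,\Box A'$, $(\forall x A)'=\forall x\,A'$. Define the Gödel (Rasiowa–Sikorski) translation $A^{\Box}$ in the same way on atomic formulas, and by: it commutes with $\vee,\wedge,\exists$, and $(A\supset B)^\Box=\Box(A^\Box\supset B^\Box)$, $(\forall xA)^\Box=\Box\forall x A^\Box$. **Corollary 2.2.** $\mathbf{EQC}$ is a conservative extension of $\mathbf{IQC}$, and $\mathbf{EA}$ is a conservative extension of $\mathbf{HA}$, in the following sense (intuitionistic formulas being read in the modal language through the translation). For every formula $A$ of $\mathbf{IQC}$ in the language $L$ (possibly with free variables), $$\vdash_{\mathbf{IQC}}A\ \Rightarrow\ \vdash_{\mathbf{EQC}}A,\qquad \vdash_{\mathbf{IQC}}A\iff\vdash_{\mathbf{EQC}}A^{\Box_{\mathbf{RS}}},\qquad \vdash_{\mathbf{IQC}}A\iff\vdash_{\mathbf{EQC}}A^{\Box};$$ and for every formula $A$ of $\mathbf{HA}$, $$\vdash_{\mathbf{HA}}A\ \Rightarrow\ \vdash_{\mathbf{EA}}A,\qquad \vdash_{\mathbf{HA}}A\iff\vdash_{\mathbf{EA}}A^{\Box_{\mathbf{RS}}},\qquad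 \vdash_{\mathbf{HA}}A\iff\vdash_{\mathbf{EA}}A^{\Box}.$$ -/

import Mathlib

universe u v

namespace Epistemic

/-! Terms are the terms of a first-order language `L` over the variables `0, 1, 2, …`.
Formulas use de Bruijn indices: inside a quantifier the variable `0` is the bound one, and the
variable `n + 1` is the variable `n` of the surrounding formula. -/

section Terms

variable {L : FirstOrder.Language.{u, v}}

/-- The substitution `σ` moved below one quantifier. -/
def up (σ : ℕ → L.Term ℕ) : ℕ → L.Term ℕ
  | 0 => FirstOrder.Language.Term.var 0
  | n + 1 => (σ n).relabel Nat.succ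

/-- The substitution of `t` for the variable `0`, all other variables being moved down by one. -/
def inst (t : L.Term ℕ) : ℕ → L.Term ℕ
  | 0 => t
  | n + 1 => FirstOrder.Language.Term.var n

/-- The renaming of every variable `n` to `n + 1`. -/
def shift : ℕ → L.Term ℕ := fun n => FirstOrder.Language.Term.var (n + 1)

end Terms

/-- Formulas of intuitionistic first-order logic with equality, with primitives
`⊥, =, ∧, ∨, ⊃, ∀, ∃`. -/
inductive IFormula (L : FirstOrder.Language.{u, v}) : Type (max u v)
  | falsum : IFormula L
  | equal (s t : L.Term ℕ) : IFormula L
  | rel {n : ℕ} (R : L.Relations n) (ts : Fin n → L.Term ℕ) : IFormula L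
  | and (A B : IFormula L) : IFormula L
  | or (A B : IFormula L) : IFormula L
  | imp (A B : IFormula L) : IFormula L
  | all (A : IFormula L) : IFormula L
  | ex (A : IFormula L) : IFormula L

/-- Formulas of modal (epistemic) first-order logic with equality: the above and `□`. -/
inductive MFormula (L : FirstOrder.Language.{u, v}) : Type (max u v)
  | falsum : MFormula L
  | equal (s t : L.Term ℕ) : MFormula L
  | rel {n : ℕ} (R : L.Relations n) (ts : Fin n → L.Term ℕ) : MFormula L
  | and (A B : MFormula L) : MFormula L
  | or (A B : MFormula L) : MFormula L
  | imp (A B : MFormula L) : MFormula L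
  | all (A : MFormula L) : MFormula L
  | ex (A : MFormula L) : MFormula L
  | box (A : MFormula L) : MFormula L

namespace IFormula

variable {L : FirstOrder.Language.{u, v}}

/-- Capture-avoiding simultaneous substitution of `σ n` for each free variable `n`. -/
def subst : IFormula L → (ℕ → L.Term ℕ) → IFormula L
  | falsum, _ => falsum
  | equal s t, σ => equal (s.subst σ) (t.subst σ)
  | rel R ts, σ => rel R (fun i => (ts i).subst σ)
  | and A B, σ => and (A.subst σ) (B.subst σ)
  | or A B, σ => or (A.subst σ) (B.subst σ)
  | imp A B, σ => imp (A.subst σ) (B.subst σ)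
  | all A, σ => all (A.subst (up σ))
  | ex A, σ => ex (A.subst (up σ))

/-- `¬ A` is `A ⊃ ⊥`. -/
def neg (A : IFormula L) : IFormula L := imp A falsum

end IFormula

namespace MFormula

variable {L : FirstOrder.Language.{u, v}}

/-- Capture-avoiding simultaneous substitution of `σ n` for each free variable `n`. -/
def subst : MFormula L → (ℕ → L.Term ℕ) → MFormula L
  | falsum, _ => falsum
  | equal s t, σ => equal (s.subst σ) (t.subst σ)
  | rel R ts, σ => rel R (fun i => (ts i).subst σ)
  | and A B, σ => and (A.subst σ) (B.subst σ)
  | or A B, σ => or (A.subst σ) (B.subst σ)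
  | imp A B, σ => imp (A.subst σ) (B.subst σ)
  | all A, σ => all (A.subst (up σ))
  | ex A, σ => ex (A.subst (up σ))
  | box A, σ => box (A.subst σ)

/-- `¬ A` is `A ⊃ ⊥`. -/
def neg (A : MFormula L) : MFormula L := imp A falsum

end MFormula

/-- `IDerivable Ax Γ A`: there is a natural deduction derivation of `A`, in intuitionistic
first-order logic with equality and the axioms `Ax`, with open assumptions among `Γ`.
The usual variable conditions of `∀I` and `∃E` are expressed by shifting. -/
inductive IDerivable {L : FirstOrder.Language.{u, v}} (Ax : Set (IFormula L)) :
    List (IFormula L) → IFormula L → Prop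
  | ax {Γ : List (IFormula L)} {A : IFormula L} : A ∈ Ax → IDerivable Ax Γ A
  | assumption {Γ : List (IFormula L)} {A : IFormula L} : A ∈ Γ → IDerivable Ax Γ A
  | andI {Γ : List (IFormula L)} {A B : IFormula L} :
      IDerivable Ax Γ A → IDerivable Ax Γ B → IDerivable Ax Γ (A.and B)
  | andE₀ {Γ : List (IFormula L)} {A B : IFormula L} :
      IDerivable Ax Γ (A.and B) → IDerivable Ax Γ A
  | andE₁ {Γ : List (IFormula L)} {A B : IFormula L} :
      IDerivable Ax Γ (A.and B) → IDerivable Ax Γ B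
  | orI₀ {Γ : List (IFormula L)} {A B : IFormula L} :
      IDerivable Ax Γ A → IDerivable Ax Γ (A.or B)
  | orI₁ {Γ : List (IFormula L)} {A B : IFormula L} :
      IDerivable Ax Γ B → IDerivable Ax Γ (A.or B)
  | orE {Γ : List (IFormula L)} {A B C : IFormula L} :
      IDerivable Ax Γ (A.or B) → IDerivable Ax (A :: Γ) C → IDerivable Ax (B :: Γ) C →
      IDerivable Ax Γ C
  | impI {Γ : List (IFormula L)} {A B : IFormula L} :
      IDerivable Ax (A :: Γ) B → IDerivable Ax Γ (A.imp B)
  | impE {Γ : List (IFormula L)} {A B : IFormula L} :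
      IDerivable Ax Γ A → IDerivable Ax Γ (A.imp B) → IDerivable Ax Γ B
  | botI {Γ : List (IFormula L)} {A : IFormula L} :
      IDerivable Ax Γ IFormula.falsum → IDerivable Ax Γ A
  | exI {Γ : List (IFormula L)} {A : IFormula L} (t : L.Term ℕ) :
      IDerivable Ax Γ (A.subst (inst t)) → IDerivable Ax Γ A.ex
  | exE {Γ : List (IFormula L)} {A B : IFormula L} :
      IDerivable Ax Γ A.ex →
      IDerivable Ax (A :: Γ.map (fun C => C.subst shift)) (B.subst shift) → IDerivable Ax Γ B
  | allI {Γ : List (IFormula L)} {A : IFormula L} :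
      IDerivable Ax (Γ.map (fun C => C.subst shift)) A → IDerivable Ax Γ A.all
  | allE {Γ : List (IFormula L)} {A : IFormula L} (t : L.Term ℕ) :
      IDerivable Ax Γ A.all → IDerivable Ax Γ (A.subst (inst t))
  | eq {Γ : List (IFormula L)} (t : L.Term ℕ) : IDerivable Ax Γ (IFormula.equal t t)
  | sub {Γ : List (IFormula L)} {A : IFormula L} {s t : L.Term ℕ} :
      IDerivable Ax Γ (IFormula.equal s t) → IDerivable Ax Γ (A.subst (inst s)) →
      IDerivable Ax Γ (A.subst (inst t))

/-- `MDerivable Ax Γ A`: there is a natural deduction derivation of `A`, in classical first-order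
`S4` with equality and the axioms `Ax`, with open assumptions among `Γ`. In the rule `boxI`, the
list `Δ` holds the open assumptions of the derivation of `A`; axioms are not open assumptions. -/
inductive MDerivable {L : FirstOrder.Language.{u, v}} (Ax : Set (MFormula L)) :
    List (MFormula L) → MFormula L → Prop
  | ax {Γ : List (MFormula L)} {A : MFormula L} : A ∈ Ax → MDerivable Ax Γ A
  | assumption {Γ : List (MFormula L)} {A : MFormula L} : A ∈ Γ → MDerivable Ax Γ A
  | andI {Γ : List (MFormula L)} {A B : MFormula L} :
      MDerivable Ax Γ A → MDerivable Ax Γ B → MDerivable Ax Γ (A.and B)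
  | andE₀ {Γ : List (MFormula L)} {A B : MFormula L} :
      MDerivable Ax Γ (A.and B) → MDerivable Ax Γ A
  | andE₁ {Γ : List (MFormula L)} {A B : MFormula L} :
      MDerivable Ax Γ (A.and B) → MDerivable Ax Γ B
  | orI₀ {Γ : List (MFormula L)} {A B : MFormula L} :
      MDerivable Ax Γ A → MDerivable Ax Γ (A.or B)
  | orI₁ {Γ : List (MFormula L)} {A B : MFormula L} :
      MDerivable Ax Γ B → MDerivable Ax Γ (A.or B)
  | orE {Γ : List (MFormula L)} {A B C : MFormula L} :
      MDerivable Ax Γ (A.or B) → MDerivable Ax (A :: Γ) C → MDerivable Ax (B :: Γ) C →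
      MDerivable Ax Γ C
  | impI {Γ : List (MFormula L)} {A B : MFormula L} :
      MDerivable Ax (A :: Γ) B → MDerivable Ax Γ (A.imp B)
  | impE {Γ : List (MFormula L)} {A B : MFormula L} :
      MDerivable Ax Γ A → MDerivable Ax Γ (A.imp B) → MDerivable Ax Γ B
  | exI {Γ : List (MFormula L)} {A : MFormula L} (t : L.Term ℕ) :
      MDerivable Ax Γ (A.subst (inst t)) → MDerivable Ax Γ A.ex
  | exE {Γ : List (MFormula L)} {A B : MFormula L} :
      MDerivable Ax Γ A.ex →
      MDerivable Ax (A :: Γ.map (fun C => C.subst shift)) (B.subst shift) → MDerivable Ax Γ B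
  | allI {Γ : List (MFormula L)} {A : MFormula L} :
      MDerivable Ax (Γ.map (fun C => C.subst shift)) A → MDerivable Ax Γ A.all
  | allE {Γ : List (MFormula L)} {A : MFormula L} (t : L.Term ℕ) :
      MDerivable Ax Γ A.all → MDerivable Ax Γ (A.subst (inst t))
  | eq {Γ : List (MFormula L)} (t : L.Term ℕ) : MDerivable Ax Γ (MFormula.equal t t)
  | sub {Γ : List (MFormula L)} {A : MFormula L} {s t : L.Term ℕ} :
      MDerivable Ax Γ (MFormula.equal s t) → MDerivable Ax Γ (A.subst (inst s)) →
      MDerivable Ax Γ (A.subst (inst t))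
  | boxI {Γ Δ : List (MFormula L)} {A : MFormula L} :
      (∀ B ∈ Δ, ∃ C : MFormula L, B = C.box) → Δ ⊆ Γ → MDerivable Ax Δ A →
      MDerivable Ax Γ A.box
  | boxE {Γ : List (MFormula L)} {A : MFormula L} :
      MDerivable Ax Γ A.box → MDerivable Ax Γ A
  | botC {Γ : List (MFormula L)} {A : MFormula L} :
      MDerivable Ax (A.neg :: Γ) MFormula.falsum → MDerivable Ax Γ A

/-- `⊢ A` in intuitionistic first-order logic with equality, in the language `L`. -/
def IQC {L : FirstOrder.Language.{u, v}} (A : IFormula L) : Prop := IDerivable ∅ [] A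

/-- `⊢ A` in classical first-order `S4` with equality, in the language `L`. -/
def EQC {L : FirstOrder.Language.{u, v}} (A : MFormula L) : Prop := MDerivable ∅ [] A

/-! The language of arithmetic: `0`, `s`, `+`, `·`, and no relation symbol besides equality. -/

inductive ArithFunc : ℕ → Type
  | zero : ArithFunc 0
  | succ : ArithFunc 1
  | add : ArithFunc 2
  | mul : ArithFunc 2

def arith : FirstOrder.Language.{0, 0} := ⟨ArithFunc, fun _ => Empty⟩

namespace Arith

def zero : arith.Term ℕ := FirstOrder.Language.Term.func (L := arith) (l := 0) ArithFunc.zero ![]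

def succ (t : arith.Term ℕ) : arith.Term ℕ :=
  FirstOrder.Language.Term.func (L := arith) (l := 1) ArithFunc.succ ![t]

def add (s t : arith.Term ℕ) : arith.Term ℕ :=
  FirstOrder.Language.Term.func (L := arith) (l := 2) ArithFunc.add ![s, t]

def mul (s t : arith.Term ℕ) : arith.Term ℕ :=
  FirstOrder.Language.Term.func (L := arith) (l := 2) ArithFunc.mul ![s, t]

/-- The variable `n`. -/
def x (n : ℕ) : arith.Term ℕ := FirstOrder.Language.Term.var n

/-- The substitution of `s(x)` for the variable `x` of index `0`, all others unchanged. -/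
def succSubst : ℕ → arith.Term ℕ
  | 0 => succ (x 0)
  | n + 1 => x (n + 1)

end Arith

open Arith in
/-- The non-logical axioms of Heyting arithmetic; formulas in the induction scheme may contain
free variables as parameters. -/
inductive HAAxiom : IFormula arith → Prop
  | succ_ne_zero : HAAxiom (IFormula.equal (succ (x 0)) zero).neg.all
  | succ_inj : HAAxiom
      ((IFormula.equal (succ (x 1)) (succ (x 0))).imp (IFormula.equal (x 1) (x 0))).all.all
  | add_zero : HAAxiom (IFormula.equal (add (x 0) zero) (x 0)).all
  | add_succ : HAAxiom
      (IFormula.equal (add (x 1) (succ (x 0))) (succ (add (x 1) (x 0)))).all.all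
  | mul_zero : HAAxiom (IFormula.equal (mul (x 0) zero) zero).all
  | mul_succ : HAAxiom
      (IFormula.equal (mul (x 1) (succ (x 0))) (add (mul (x 1) (x 0)) (x 1))).all.all
  | induction (A : IFormula arith) : HAAxiom
      (((A.subst (inst zero)).and (A.imp (A.subst succSubst)).all).imp A.all)

open Arith in
/-- The non-logical axioms of epistemic arithmetic; induction is for all modal formulas. -/
inductive EAAxiom : MFormula arith → Prop
  | succ_ne_zero : EAAxiom (MFormula.equal (succ (x 0)) zero).neg.all
  | succ_inj : EAAxiom
      ((MFormula.equal (succ (x 1)) (succ (x 0))).imp (MFormula.equal (x 1) (x 0))).all.all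
  | add_zero : EAAxiom (MFormula.equal (add (x 0) zero) (x 0)).all
  | add_succ : EAAxiom
      (MFormula.equal (add (x 1) (succ (x 0))) (succ (add (x 1) (x 0)))).all.all
  | mul_zero : EAAxiom (MFormula.equal (mul (x 0) zero) zero).all
  | mul_succ : EAAxiom
      (MFormula.equal (mul (x 1) (succ (x 0))) (add (mul (x 1) (x 0)) (x 1))).all.all
  | induction (A : MFormula arith) : EAAxiom
      (((A.subst (inst zero)).and (A.imp (A.subst succSubst)).all).imp A.all)

/-- `⊢ A` in Heyting arithmetic. -/
def HA (A : IFormula arith) : Prop := IDerivable {B | HAAxiom B} [] A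

/-- `⊢ A` in epistemic arithmetic. -/
def EA (A : MFormula arith) : Prop := MDerivable {B | EAAxiom B} [] A

namespace IFormula

variable {L : FirstOrder.Language.{u, v}}

/-- The inclusion of the intuitionistic language in the modal language. -/
def toModal : IFormula L → MFormula L
  | falsum => .falsum
  | equal s t => .equal s t
  | rel R ts => .rel R ts
  | and A B => .and A.toModal B.toModal
  | or A B => .or A.toModal B.toModal
  | imp A B => .imp A.toModal B.toModal
  | all A => .all A.toModal
  | ex A => .ex A.toModal

/-- The Gödel (or Rasiowa–Sikorski) translation. -/
def boxTranslation : IFormula L → MFormula L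
  | falsum => .falsum
  | equal s t => .equal s t
  | rel R ts => .box (.rel R ts)
  | and A B => .and A.boxTranslation B.boxTranslation
  | or A B => .or A.boxTranslation B.boxTranslation
  | imp A B => .box (.imp A.boxTranslation B.boxTranslation)
  | all A => .box (.all A.boxTranslation)
  | ex A => .ex A.boxTranslation

/-- The modified Rasiowa–Sikorski translation. -/
def rsTranslation : IFormula L → MFormula L
  | falsum => .falsum
  | equal s t => .equal s t
  | rel R ts => .box (.rel R ts)
  | and A B => .and A.rsTranslation B.rsTranslation
  | or A B => .or (.box A.rsTranslation) (.box B.rsTranslation)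
  | imp A B => .box (.imp (.box A.rsTranslation) (.box B.rsTranslation))
  | all A => .all A.rsTranslation
  | ex A => .ex (.box A.rsTranslation)

end IFormula

end Epistemic

/-! Soundness of the Gödel translation is an induction on derivations: every `A.boxTranslation`
proves its own necessitation (`MDerivable.boxTranslation_stable`), so the □ demanded at ⊃I and ∀I is
available. The modified translation reduces to it, because its □ is equivalent to the Gödel
translation (`MDerivable.box_rsTranslation_iff`).

Faithfulness is proved syntactically. For each intuitionistic formula `E`, modal formulas are read
intuitionistically through double negation relative to `E`: ⊥ becomes `E`, so classical reductio is
sound. □A is read, up to that double negation, as "the reading of A holds relative to every instance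
of every formula in a finite list `G`". This conjunction does not mention `E`, which makes
necessitation sound, and it can be instantiated at any `E` that is an instance of `G`, which makes
□E sound.

If `G` contains the subformulas of `A`, the reading of `A.boxTranslation` relative to `E` is
equivalent to (A ⊃ E) ⊃ E (`relTranslation_boxTranslation_iff`): a boxed clause is unpacked by
choosing as `E` a subformula `B`, since (B ⊃ B) ⊃ B yields `B`. Taking `E` to be `A` itself returns
a derivation of `A`. In arithmetic the reading sends induction to induction. -/

namespace Epistemic

open FirstOrder.Language (Term)

/-! ### Substitution calculus and bounds on free variables. -/

section Substitution

variable {L : FirstOrder.Language.{u, v}}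

/-- The composition of two substitutions, `σ` being performed first. -/
def comp (σ τ : ℕ → L.Term ℕ) : ℕ → L.Term ℕ := fun n => (σ n).subst τ

theorem Term.subst_subst (t : L.Term ℕ) (σ τ : ℕ → L.Term ℕ) :
    (t.subst σ).subst τ = t.subst (comp σ τ) := by
  induction t with
  | var n => rfl
  | func f ts ih => simp [Term.subst, ih]

theorem Term.relabel_eq_subst (t : L.Term ℕ) (g : ℕ → ℕ) :
    t.relabel g = t.subst (fun n => Term.var (g n)) := by
  induction t with
  | var n => rfl
  | func f ts ih => simp [Term.subst, Term.relabel, ih]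

theorem Term.subst_var (t : L.Term ℕ) : t.subst Term.var = t := by
  induction t with
  | var n => rfl
  | func f ts ih => simp [Term.subst, ih]

theorem Term.relabel_succ (t : L.Term ℕ) : t.relabel Nat.succ = t.subst shift :=
  Term.relabel_eq_subst t _

theorem comp_var (σ : ℕ → L.Term ℕ) : comp σ Term.var = σ :=
  funext fun n => Term.subst_var (σ n)

theorem comp_assoc (σ τ υ : ℕ → L.Term ℕ) : comp (comp σ τ) υ = comp σ (comp τ υ) :=
  funext fun n => Term.subst_subst (σ n) τ υ

theorem up_var : up (Term.var : ℕ → L.Term ℕ) = Term.var := by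
  funext n
  cases n <;> rfl

theorem up_succ (σ : ℕ → L.Term ℕ) (n : ℕ) : up σ (n + 1) = (σ n).subst shift :=
  Term.relabel_succ _

theorem shift_comp_up (σ : ℕ → L.Term ℕ) : comp shift (up σ) = comp σ shift :=
  funext fun n => up_succ σ n

theorem up_comp (σ τ : ℕ → L.Term ℕ) : up (comp σ τ) = comp (up σ) (up τ) := by
  funext n
  cases n with
  | zero => rfl
  | succ n =>
    show _ = (up σ (n + 1)).subst (up τ)
    rw [up_succ, up_succ, Term.subst_subst, shift_comp_up, ← Term.subst_subst]
    rfl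

theorem shift_comp_inst (t : L.Term ℕ) : comp shift (inst t) = Term.var := rfl

theorem inst_comp (t : L.Term ℕ) (σ : ℕ → L.Term ℕ) :
    comp (inst t) σ = comp (up σ) (inst (t.subst σ)) := by
  funext n
  cases n with
  | zero => rfl
  | succ n =>
    show _ = (up σ (n + 1)).subst _
    rw [up_succ, Term.subst_subst, shift_comp_inst, Term.subst_var]
    rfl

theorem up_shift_comp_inst_zero :
    comp (up shift) (inst (Term.var 0)) = (Term.var : ℕ → L.Term ℕ) := by
  funext n
  cases n <;> rfl

theorem IFormula.subst_subst (A : IFormula L) (σ τ : ℕ → L.Term ℕ) :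
    (A.subst σ).subst τ = A.subst (comp σ τ) := by
  induction A generalizing σ τ with
  | falsum => rfl
  | equal s t => simp [subst, Term.subst_subst]
  | rel R ts => simp [subst, Term.subst_subst]
  | and A B hA hB => simp [subst, hA, hB]
  | or A B hA hB => simp [subst, hA, hB]
  | imp A B hA hB => simp [subst, hA, hB]
  | all A hA => simp [subst, hA, up_comp]
  | ex A hA => simp [subst, hA, up_comp]

theorem IFormula.subst_var (A : IFormula L) : A.subst Term.var = A := by
  induction A with
  | falsum => rfl
  | equal s t => simp [subst, Term.subst_var]
  | rel R ts => simp [subst, Term.subst_var]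
  | and A B hA hB => simp [subst, hA, hB]
  | or A B hA hB => simp [subst, hA, hB]
  | imp A B hA hB => simp [subst, hA, hB]
  | all A hA => simp [subst, hA, up_var]
  | ex A hA => simp [subst, hA, up_var]

theorem MFormula.subst_subst (A : MFormula L) (σ τ : ℕ → L.Term ℕ) :
    (A.subst σ).subst τ = A.subst (comp σ τ) := by
  induction A generalizing σ τ with
  | falsum => rfl
  | equal s t => simp [subst, Term.subst_subst]
  | rel R ts => simp [subst, Term.subst_subst]
  | and A B hA hB => simp [subst, hA, hB]
  | or A B hA hB => simp [subst, hA, hB]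
  | imp A B hA hB => simp [subst, hA, hB]
  | all A hA => simp [subst, hA, up_comp]
  | ex A hA => simp [subst, hA, up_comp]
  | box A hA => simp [subst, hA]

theorem MFormula.subst_var (A : MFormula L) : A.subst Term.var = A := by
  induction A with
  | falsum => rfl
  | equal s t => simp [subst, Term.subst_var]
  | rel R ts => simp [subst, Term.subst_var]
  | and A B hA hB => simp [subst, hA, hB]
  | or A B hA hB => simp [subst, hA, hB]
  | imp A B hA hB => simp [subst, hA, hB]
  | all A hA => simp [subst, hA, up_var]
  | ex A hA => simp [subst, hA, up_var]
  | box A hA => simp [subst, hA]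

/-- `DependsBelow N A`: the free variables of `A` are below `N`. -/
def DependsBelow (N : ℕ) (A : IFormula L) : Prop :=
  ∀ σ τ : ℕ → L.Term ℕ, (∀ k < N, σ k = τ k) → A.subst σ = A.subst τ

theorem DependsBelow.mono {M N : ℕ} {A : IFormula L} (h : DependsBelow M A) (hMN : M ≤ N) :
    DependsBelow N A :=
  fun σ τ hst => h σ τ fun k hk => hst k (hk.trans_le hMN)

theorem Term.exists_subst_eq (t : L.Term ℕ) : ∃ N : ℕ, ∀ σ τ : ℕ → L.Term ℕ,
    (∀ k < N, σ k = τ k) → t.subst σ = t.subst τ := by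
  induction t with
  | var n => exact ⟨n + 1, fun σ τ h => h n n.lt_succ_self⟩
  | func f ts ih =>
    choose N hN using ih
    refine ⟨Finset.univ.sup N, fun σ τ h => ?_⟩
    simp only [Term.subst]
    congr 1
    funext i
    exact hN i σ τ fun k hk => h k (hk.trans_le (Finset.le_sup (Finset.mem_univ i)))

theorem up_eq_of_lt {N : ℕ} {σ τ : ℕ → L.Term ℕ} (h : ∀ k < N, σ k = τ k) :
    ∀ k < N, up σ k = up τ k := by
  intro k hk
  cases k with
  | zero => rfl
  | succ k => rw [up_succ, up_succ, h k (by omega)]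

theorem exists_dependsBelow (A : IFormula L) : ∃ N, DependsBelow N A := by
  induction A with
  | falsum => exact ⟨0, fun _ _ _ => rfl⟩
  | equal s t =>
    obtain ⟨M, hM⟩ := Term.exists_subst_eq s
    obtain ⟨N, hN⟩ := Term.exists_subst_eq t
    refine ⟨max M N, fun σ τ h => ?_⟩
    simp only [IFormula.subst]
    rw [hM σ τ fun k hk => h k (by omega), hN σ τ fun k hk => h k (by omega)]
  | rel R ts =>
    choose N hN using fun i => Term.exists_subst_eq (ts i)
    refine ⟨Finset.univ.sup N, fun σ τ h => ?_⟩
    simp only [IFormula.subst]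
    congr 1
    funext i
    exact hN i σ τ fun k hk => h k (hk.trans_le (Finset.le_sup (Finset.mem_univ i)))
  | and A B hA hB | or A B hA hB | imp A B hA hB =>
    obtain ⟨M, hM⟩ := hA
    obtain ⟨N, hN⟩ := hB
    refine ⟨max M N, fun σ τ h => ?_⟩
    simp only [IFormula.subst]
    rw [hM σ τ fun k hk => h k (by omega), hN σ τ fun k hk => h k (by omega)]
  | all A hA | ex A hA =>
    obtain ⟨M, hM⟩ := hA
    refine ⟨M, fun σ τ h => ?_⟩
    simp only [IFormula.subst]
    rw [hM _ _ (up_eq_of_lt h)]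

/-- Finiteness of `G` matters here: one block of `N` quantifiers then closes all its members, so
"all instances of `G`" is a single formula. -/
theorem exists_dependsBelow_list (G : List (IFormula L)) : ∃ N, ∀ F ∈ G, DependsBelow N F := by
  induction G with
  | nil => exact ⟨0, by simp⟩
  | cons A G ih =>
    obtain ⟨M, hM⟩ := ih
    obtain ⟨N, hN⟩ := exists_dependsBelow A
    refine ⟨max M N, fun F hF => ?_⟩
    rcases List.mem_cons.1 hF with rfl | hF
    · exact hN.mono (le_max_right _ _)
    · exact (hM F hF).mono (le_max_left _ _)

/-- The renaming of every variable `n` to `n + N`. -/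
def shiftBy (N : ℕ) : ℕ → L.Term ℕ := fun n => Term.var (n + N)

/-- The substitution of `σ k` for the variables `k < N`, all other variables being moved down
by `N`. -/
def instBelow (N : ℕ) (σ : ℕ → L.Term ℕ) : ℕ → L.Term ℕ :=
  fun k => if k < N then σ k else Term.var (k - N)

theorem shiftBy_comp_instBelow (N : ℕ) (σ : ℕ → L.Term ℕ) :
    comp (shiftBy N) (instBelow N σ) = Term.var := by
  funext n
  simp [comp, shiftBy, instBelow, Term.subst]

theorem shiftBy_comp_shift (N : ℕ) :
    comp (shiftBy N) shift = (shiftBy (N + 1) : ℕ → L.Term ℕ) := rfl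

theorem shiftBy_comp_iterate_up (N : ℕ) (σ : ℕ → L.Term ℕ) :
    comp (shiftBy N) (up^[N] σ) = comp σ (shiftBy N) := by
  induction N with
  | zero => exact (comp_var σ).symm
  | succ N ih =>
    rw [Function.iterate_succ', Function.comp, ← shiftBy_comp_shift, comp_assoc, shift_comp_up,
      ← comp_assoc, ih, comp_assoc]

theorem iterate_up_of_lt {N k : ℕ} (σ : ℕ → L.Term ℕ) (hk : k < N) :
    up^[N] σ k = Term.var k := by
  induction N generalizing k with
  | zero => omega
  | succ N ih =>
    rw [Function.iterate_succ', Function.comp]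
    cases k with
    | zero => rfl
    | succ k => rw [up_succ, ih (by omega)]; rfl

/-- A substitution pushed below `N` quantifiers fixes the variables they bind, and `A` has no
others. -/
theorem DependsBelow.subst_iterate_up {N : ℕ} {A : IFormula L} (h : DependsBelow N A)
    (σ : ℕ → L.Term ℕ) : A.subst (up^[N] σ) = A :=
  (h _ Term.var fun _ hk => iterate_up_of_lt σ hk).trans A.subst_var

theorem DependsBelow.subst_instBelow {N : ℕ} {A : IFormula L} (h : DependsBelow N A)
    (σ : ℕ → L.Term ℕ) : A.subst (instBelow N σ) = A.subst σ :=
  h _ _ fun _ hk => if_pos hk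

end Substitution

/-! ### Intuitionistic derivations, relative double negation, quantifier blocks. -/

section Intuitionistic

variable {L : FirstOrder.Language.{u, v}} {Ax : Set (IFormula L)}

theorem IDerivable.weaken {Γ Δ : List (IFormula L)} {A : IFormula L} (h : IDerivable Ax Γ A)
    (hs : Γ ⊆ Δ) : IDerivable Ax Δ A := by
  induction h generalizing Δ with
  | ax h => exact .ax h
  | assumption h => exact .assumption (hs h)
  | andI _ _ h₁ h₂ => exact .andI (h₁ hs) (h₂ hs)
  | andE₀ _ h => exact .andE₀ (h hs)
  | andE₁ _ h => exact .andE₁ (h hs)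
  | orI₀ _ h => exact .orI₀ (h hs)
  | orI₁ _ h => exact .orI₁ (h hs)
  | orE _ _ _ h h₁ h₂ =>
    exact .orE (h hs) (h₁ (List.cons_subset_cons _ hs)) (h₂ (List.cons_subset_cons _ hs))
  | impI _ h => exact .impI (h (List.cons_subset_cons _ hs))
  | impE _ _ h₁ h₂ => exact .impE (h₁ hs) (h₂ hs)
  | botI _ h => exact .botI (h hs)
  | exI t _ h => exact .exI t (h hs)
  | exE _ _ h₁ h₂ => exact .exE (h₁ hs) (h₂ (List.cons_subset_cons _ (List.map_subset _ hs)))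
  | allI _ h => exact .allI (h (List.map_subset _ hs))
  | allE t _ h => exact .allE t (h hs)
  | eq t => exact .eq t
  | sub _ _ h₁ h₂ => exact .sub (h₁ hs) (h₂ hs)

theorem IDerivable.weaken_cons {Γ : List (IFormula L)} {A : IFormula L} (B : IFormula L)
    (h : IDerivable Ax Γ A) : IDerivable Ax (B :: Γ) A :=
  h.weaken (List.subset_cons_self _ _)

theorem IDerivable.head {Γ : List (IFormula L)} {A : IFormula L} : IDerivable Ax (A :: Γ) A :=
  .assumption List.mem_cons_self

/-- Discarding the rest of the context means that a later ∀I shifts only the one formula `A`. -/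
theorem IDerivable.cut {Γ : List (IFormula L)} {A B : IFormula L} (hA : IDerivable Ax Γ A)
    (h : IDerivable Ax [A] B) : IDerivable Ax Γ B :=
  .impE hA (.impI (h.weaken (by simp)))

theorem IFormula.subst_shift_inst_zero (A : IFormula L) :
    (A.subst (up shift)).subst (inst (Term.var 0)) = A := by
  rw [subst_subst, up_shift_comp_inst_zero, subst_var]

theorem IFormula.subst_shift_inst (A : IFormula L) (t : L.Term ℕ) :
    (A.subst shift).subst (inst t) = A := by
  rw [subst_subst, shift_comp_inst, subst_var]

theorem IDerivable.all_shift {Γ : List (IFormula L)} {A : IFormula L}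
    (h : IDerivable Ax Γ (A.all.subst shift)) : IDerivable Ax Γ A := by
  have := IDerivable.allE (Term.var 0) h
  rwa [A.subst_shift_inst_zero] at this

theorem IDerivable.ex_shift {Γ : List (IFormula L)} {A : IFormula L}
    (h : IDerivable Ax Γ A) : IDerivable Ax Γ (A.ex.subst shift) :=
  .exI (Term.var 0) (by rwa [A.subst_shift_inst_zero])

/-- The double negation of `X` relative to `E`. -/
def relNN (E X : IFormula L) : IFormula L := (X.imp E).imp E

theorem relNN_subst (E X : IFormula L) (σ : ℕ → L.Term ℕ) :
    (relNN E X).subst σ = relNN (E.subst σ) (X.subst σ) := rfl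

theorem IDerivable.relNN_intro {Γ : List (IFormula L)} {X : IFormula L} (E : IFormula L)
    (h : IDerivable Ax Γ X) : IDerivable Ax Γ (relNN E X) :=
  .impI (.impE (h.weaken_cons _) .head)

/-- Relative double negation is a monad; this is its bind, and ex falso is not needed for it. -/
theorem IDerivable.relNN_bind {Γ : List (IFormula L)} {E X Y : IFormula L}
    (h : IDerivable Ax Γ (relNN E X)) (hXY : IDerivable Ax (X :: Γ) (relNN E Y)) :
    IDerivable Ax Γ (relNN E Y) :=
  .impI (.impE (.impI (.impE (.assumption (by simp)) (hXY.weaken (by grind))))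
    (h.weaken_cons _))

theorem IDerivable.relNN_self {Γ : List (IFormula L)} {E : IFormula L}
    (h : IDerivable Ax Γ (relNN E E)) : IDerivable Ax Γ E :=
  .impE (.impI .head) h

/-- The universal quantification of the variables below `N`. -/
def allN : ℕ → IFormula L → IFormula L
  | 0, A => A
  | N + 1, A => allN N A.all

theorem allN_subst (N : ℕ) (A : IFormula L) (σ : ℕ → L.Term ℕ) :
    (allN N A).subst σ = allN N (A.subst (up^[N] σ)) := by
  induction N generalizing A with
  | zero => rfl
  | succ N ih => rw [allN, ih, allN, Function.iterate_succ']; rfl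

theorem IDerivable.allN_intro {N : ℕ} {Γ : List (IFormula L)} {A : IFormula L}
    (h : IDerivable Ax (Γ.map fun C => C.subst (shiftBy N)) A) : IDerivable Ax Γ (allN N A) := by
  induction N generalizing A with
  | zero =>
    have : (Γ.map fun C => C.subst (shiftBy 0)) = Γ :=
      (List.map_congr_left fun C _ => C.subst_var).trans (List.map_id _)
    rwa [this] at h
  | succ N ih =>
    refine ih (.allI ?_)
    simpa [Function.comp_def, IFormula.subst_subst, shiftBy_comp_shift] using h

theorem IDerivable.allN_elim {N : ℕ} {Γ : List (IFormula L)} {A : IFormula L}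
    (h : IDerivable Ax Γ (allN N A)) (σ : ℕ → L.Term ℕ) :
    IDerivable Ax Γ (A.subst (instBelow N σ)) := by
  induction N generalizing A σ with
  | zero =>
    have : instBelow 0 σ = Term.var := by funext n; simp [instBelow]
    rwa [this, A.subst_var]
  | succ N ih =>
    -- The innermost quantifier binds variable 0; the `N` outer ones bind what is variable `n + 1`
    -- inside it, hence the shifted values of `σ`.
    have h' := IDerivable.allE (σ 0) (ih h fun n => σ (n + 1))
    rw [IFormula.subst_subst] at h'
    convert h' using 2
    funext n
    cases n with
    | zero => simp [instBelow, comp, up, inst, Term.subst]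
    | succ n =>
      rw [comp, up_succ, Term.subst_subst, shift_comp_inst, Term.subst_var]
      simp [instBelow]

/-- The conjunction of the formulas in a list. -/
def bigAnd : List (IFormula L) → IFormula L
  | [] => IFormula.falsum.imp IFormula.falsum
  | A :: l => A.and (bigAnd l)

theorem bigAnd_subst (l : List (IFormula L)) (σ : ℕ → L.Term ℕ) :
    (bigAnd l).subst σ = bigAnd (l.map fun A => A.subst σ) := by
  induction l with
  | nil => rfl
  | cons A l ih => simp [bigAnd, IFormula.subst, ih]

theorem IDerivable.bigAnd_iff {Γ l : List (IFormula L)} :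
    IDerivable Ax Γ (bigAnd l) ↔ ∀ A ∈ l, IDerivable Ax Γ A := by
  induction l with
  | nil => exact ⟨fun _ => by simp, fun _ => .impI .head⟩
  | cons A l ih =>
    simp only [List.forall_mem_cons, ← ih]
    exact ⟨fun h => ⟨.andE₀ h, .andE₁ h⟩, fun h => .andI h.1 h.2⟩

end Intuitionistic

/-! ### The relative translation and its behaviour under substitution. -/

section RelativeTranslation

variable {L : FirstOrder.Language.{u, v}} (G : List (IFormula L)) (N : ℕ)

/-- The translation of modal into intuitionistic formulas by double negations relative to `E`,
the operator `□` being read as the conjunction over all instances of the formulas in `G`, whose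
free variables are supposed to be below `N`. The substitution `ρ` is applied to the modal
formula. -/
def relTranslation : MFormula L → (ℕ → L.Term ℕ) → IFormula L → IFormula L
  | .falsum, _, E => E
  | .equal s t, ρ, E => relNN E (.equal (s.subst ρ) (t.subst ρ))
  | .rel R ts, ρ, E => relNN E (.rel R fun i => (ts i).subst ρ)
  | .and A B, ρ, E => .and (relTranslation A ρ E) (relTranslation B ρ E)
  | .or A B, ρ, E => relNN E (.or (relTranslation A ρ E) (relTranslation B ρ E))
  | .imp A B, ρ, E => .imp (relTranslation A ρ E) (relTranslation B ρ E)
  | .all A, ρ, E => .all (relTranslation A (up ρ) (E.subst shift))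
  | .ex A, ρ, E => relNN E (.ex (relTranslation A (up ρ) (E.subst shift)))
  | .box A, ρ, E =>
    relNN E (bigAnd (G.map fun F => allN N (relTranslation A (comp ρ (shiftBy N)) F)))

/-- The conjunction of the relative translations of `A` over all instances of `G`. -/
def meetTranslation (A : MFormula L) (ρ : ℕ → L.Term ℕ) : IFormula L :=
  bigAnd (G.map fun F => allN N (relTranslation G N A (comp ρ (shiftBy N)) F))

theorem relTranslation_box (A : MFormula L) (ρ : ℕ → L.Term ℕ) (E : IFormula L) :
    relTranslation G N A.box ρ E = relNN E (meetTranslation G N A ρ) := rfl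

variable {G N}

theorem relTranslation_subst_left (A : MFormula L) (σ ρ : ℕ → L.Term ℕ) (E : IFormula L) :
    relTranslation G N (A.subst σ) ρ E = relTranslation G N A (comp σ ρ) E := by
  induction A generalizing σ ρ E with
  | falsum => rfl
  | equal s t => simp [MFormula.subst, relTranslation, Term.subst_subst]
  | rel R ts => simp [MFormula.subst, relTranslation, Term.subst_subst]
  | and A B hA hB => simp [MFormula.subst, relTranslation, hA, hB]
  | or A B hA hB => simp [MFormula.subst, relTranslation, hA, hB]
  | imp A B hA hB => simp [MFormula.subst, relTranslation, hA, hB]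
  | all A hA => simp [MFormula.subst, relTranslation, hA, up_comp]
  | ex A hA => simp [MFormula.subst, relTranslation, hA, up_comp]
  | box A hA => simp [MFormula.subst, relTranslation, hA, comp_assoc]

/-- In the box clause `σ` reaches the members of `G` only below the block that closes them, so they
stay fixed and only `ρ` and the outer `E` change. -/
theorem relTranslation_subst (hG : ∀ F ∈ G, DependsBelow N F) (A : MFormula L)
    (ρ σ : ℕ → L.Term ℕ) (E : IFormula L) :
    (relTranslation G N A ρ E).subst σ = relTranslation G N A (comp ρ σ) (E.subst σ) := by
  induction A generalizing ρ σ E with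
  | falsum => rfl
  | equal s t => simp [IFormula.subst, relTranslation, relNN_subst, Term.subst_subst]
  | rel R ts => simp [IFormula.subst, relTranslation, relNN_subst, Term.subst_subst]
  | and A B hA hB => simp [IFormula.subst, relTranslation, hA, hB]
  | or A B hA hB => simp [IFormula.subst, relTranslation, relNN_subst, hA, hB]
  | imp A B hA hB => simp [IFormula.subst, relTranslation, hA, hB]
  | all A hA =>
    simp [IFormula.subst, relTranslation, hA, up_comp, IFormula.subst_subst, shift_comp_up]
  | ex A hA =>
    simp [IFormula.subst, relTranslation, relNN_subst, hA, up_comp, IFormula.subst_subst,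
      shift_comp_up]
  | box A hA =>
    simp only [relTranslation, relNN_subst, bigAnd_subst, List.map_map]
    congr 2
    refine List.map_congr_left fun F hF => ?_
    simp [allN_subst, hA, (hG F hF).subst_iterate_up, comp_assoc, shiftBy_comp_iterate_up]

theorem meetTranslation_subst (hG : ∀ F ∈ G, DependsBelow N F) (A : MFormula L)
    (ρ σ : ℕ → L.Term ℕ) :
    (meetTranslation G N A ρ).subst σ = meetTranslation G N A (comp ρ σ) := by
  simp only [meetTranslation, bigAnd_subst, List.map_map]
  congr 1
  refine List.map_congr_left fun F hF => ?_
  simp [allN_subst, relTranslation_subst hG, (hG F hF).subst_iterate_up, comp_assoc,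
    shiftBy_comp_iterate_up]

theorem relTranslation_up_inst (hG : ∀ F ∈ G, DependsBelow N F) (A : MFormula L)
    (ρ : ℕ → L.Term ℕ) (E : IFormula L) (t : L.Term ℕ) :
    (relTranslation G N A (up ρ) (E.subst shift)).subst (inst (t.subst ρ)) =
      relTranslation G N (A.subst (inst t)) ρ E := by
  rw [relTranslation_subst hG, relTranslation_subst_left, inst_comp, E.subst_shift_inst]

theorem relTranslation_shift_up (hG : ∀ F ∈ G, DependsBelow N F) (A : MFormula L)
    (ρ : ℕ → L.Term ℕ) (E : IFormula L) :
    relTranslation G N (A.subst shift) (up ρ) (E.subst shift) =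
      (relTranslation G N A ρ E).subst shift := by
  rw [relTranslation_subst hG, relTranslation_subst_left, shift_comp_up]

/-! ### Soundness of the relative translation for classical S4. -/

variable {Ax : Set (IFormula L)}

theorem IDerivable.meetTranslation_intro {Γ : List (IFormula L)} {A : MFormula L}
    {ρ : ℕ → L.Term ℕ}
    (h : ∀ F ∈ G, IDerivable Ax (Γ.map fun C => C.subst (shiftBy N))
      (relTranslation G N A (comp ρ (shiftBy N)) F)) :
    IDerivable Ax Γ (meetTranslation G N A ρ) := by
  refine IDerivable.bigAnd_iff.2 fun X hX => ?_
  obtain ⟨F, hF, rfl⟩ := List.mem_map.1 hX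
  exact .allN_intro (h F hF)

theorem IDerivable.meetTranslation_elim (hG : ∀ F ∈ G, DependsBelow N F)
    {Γ : List (IFormula L)} {A : MFormula L} {ρ : ℕ → L.Term ℕ}
    (h : IDerivable Ax Γ (meetTranslation G N A ρ)) {F : IFormula L} (hF : F ∈ G)
    (τ : ℕ → L.Term ℕ) : IDerivable Ax Γ (relTranslation G N A ρ (F.subst τ)) := by
  have := (IDerivable.bigAnd_iff.1 h _ (List.mem_map_of_mem hF)).allN_elim τ
  rwa [relTranslation_subst hG, comp_assoc, shiftBy_comp_instBelow, comp_var,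
    (hG F hF).subst_instBelow] at this

/-- ⊥ is `E`; atoms, ∨, ∃ and □ are double negations already; ∧, ⊃ and ∀ inherit stability from
their parts. -/
theorem IDerivable.relTranslation_stable {Γ : List (IFormula L)} {A : MFormula L}
    {ρ : ℕ → L.Term ℕ} {E : IFormula L} (h : IDerivable Ax Γ (relNN E (relTranslation G N A ρ E))) :
    IDerivable Ax Γ (relTranslation G N A ρ E) := by
  induction A generalizing Γ ρ E with
  | falsum => exact h.relNN_self
  | equal s t | rel R ts | or A B hA hB | ex A hA | box A hA => exact h.relNN_bind .head
  | and A B hA hB =>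
    exact .andI (hA (h.relNN_bind (.relNN_intro _ (.andE₀ .head))))
      (hB (h.relNN_bind (.relNN_intro _ (.andE₁ .head))))
  | imp A B hA hB =>
    exact .impI (hB ((h.weaken_cons _).relNN_bind
      (.relNN_intro _ (.impE (.assumption (by simp)) .head))))
  | all A hA =>
    refine h.cut (.allI (hA ?_))
    exact IDerivable.relNN_bind (X := (relTranslation G N A.all ρ E).subst shift)
      .head (.relNN_intro _ (.all_shift .head))

theorem IDerivable.relTranslation_bind {Γ : List (IFormula L)} {A : MFormula L} {X : IFormula L}
    {ρ : ℕ → L.Term ℕ} {E : IFormula L} (h : IDerivable Ax Γ (relNN E X))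
    (hX : IDerivable Ax (X :: Γ) (relTranslation G N A ρ E)) :
    IDerivable Ax Γ (relTranslation G N A ρ E) :=
  (h.relNN_bind (.relNN_intro _ hX)).relTranslation_stable

/-- Finitely many hypotheses may be freed from their double negations when the conclusion is
a double negation. -/
theorem IDerivable.relNN_of_map {Δ Γ : List (IFormula L)} {E X : IFormula L}
    (hΔ : ∀ C ∈ Δ, IDerivable Ax Γ (relNN E C)) (h : IDerivable Ax (Δ ++ Γ) X) :
    IDerivable Ax Γ (relNN E X) := by
  induction Δ generalizing Γ with
  | nil => exact .relNN_intro _ h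
  | cons C Δ ih =>
    refine (hΔ C List.mem_cons_self).relNN_bind (ih (fun D hD => ?_) (h.weaken (by grind)))
    exact (hΔ D (List.mem_cons_of_mem _ hD)).weaken_cons _

/-- Relative formulas are restricted to instances of `G` because □E can be justified only there. All
`ρ`, `F` and `τ` are treated at once: quantifier rules change `ρ` and `τ`, and □I passes to every
`F` in `G`. -/
theorem MDerivable.relTranslation {AxM : Set (MFormula L)} (hG : ∀ F ∈ G, DependsBelow N F)
    (hAx : ∀ A ∈ AxM, ∀ ρ E, IDerivable Ax [] (relTranslation G N A ρ E))
    {Γ : List (MFormula L)} {A : MFormula L} (h : MDerivable AxM Γ A) (ρ : ℕ → L.Term ℕ)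
    {F : IFormula L} (hF : F ∈ G) (τ : ℕ → L.Term ℕ) :
    IDerivable Ax (Γ.map fun C => relTranslation G N C ρ (F.subst τ))
      (relTranslation G N A ρ (F.subst τ)) := by
  have hshift : ∀ (Γ : List (MFormula L)) (ρ : ℕ → L.Term ℕ) (τ : ℕ → L.Term ℕ) (F : IFormula L),
      (Γ.map fun C => C.subst shift).map
        (fun C => Epistemic.relTranslation G N C (up ρ) (F.subst (comp τ shift))) =
      (Γ.map fun C => Epistemic.relTranslation G N C ρ (F.subst τ)).map
        fun C => C.subst shift := by
    intro Γ ρ τ F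
    simp [← IFormula.subst_subst, relTranslation_shift_up hG]
  induction h generalizing ρ F τ with
  | ax h => exact (hAx _ h _ _).weaken (List.nil_subset _)
  | assumption h => exact .assumption (List.mem_map_of_mem h)
  | andI _ _ h₁ h₂ => exact .andI (h₁ ρ hF τ) (h₂ ρ hF τ)
  | andE₀ _ h => exact .andE₀ (h ρ hF τ)
  | andE₁ _ h => exact .andE₁ (h ρ hF τ)
  | orI₀ _ h => exact .relNN_intro _ (.orI₀ (h ρ hF τ))
  | orI₁ _ h => exact .relNN_intro _ (.orI₁ (h ρ hF τ))
  | orE _ _ _ h h₁ h₂ =>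
    exact (h ρ hF τ).relTranslation_bind
      (.orE .head ((h₁ ρ hF τ).weaken (by simp)) ((h₂ ρ hF τ).weaken (by simp)))
  | impI _ h => exact .impI (h ρ hF τ)
  | impE _ _ h₁ h₂ => exact .impE (h₁ ρ hF τ) (h₂ ρ hF τ)
  | exI t _ h =>
    refine .relNN_intro _ (.exI (t.subst ρ) ?_)
    rw [relTranslation_up_inst hG]
    exact h ρ hF τ
  | exE _ _ h₁ h₂ =>
    refine (h₁ ρ hF τ).relTranslation_bind (.exE .head ?_)
    have := h₂ (up ρ) hF (comp τ shift)
    rw [List.map_cons, hshift, ← IFormula.subst_subst, relTranslation_shift_up hG] at this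
    exact this.weaken (by simp)
  | allI _ h =>
    have := h (up ρ) hF (comp τ shift)
    rw [hshift, ← IFormula.subst_subst] at this
    exact .allI this
  | allE t _ h =>
    rw [← relTranslation_up_inst hG]
    exact .allE _ (h ρ hF τ)
  | eq t => exact .relNN_intro _ (.eq _)
  | sub _ _ h₁ h₂ =>
    refine (h₁ ρ hF τ).relTranslation_bind ?_
    have := (h₂ ρ hF τ).weaken_cons
    rw [← relTranslation_up_inst hG] at this ⊢
    exact .sub .head (this _)
  | @boxI Γ Δ A hΔ hs _ h =>
    have hm : ∀ B ∈ Δ, ∃ C : MFormula L, B = C.box ∧ ∀ ρ E,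
      Epistemic.relTranslation G N B ρ E = relNN E (meetTranslation G N C ρ) := by
      intro B hB
      obtain ⟨C, rfl⟩ := hΔ B hB
      exact ⟨C, rfl, fun _ _ => rfl⟩
    choose! c hc hc' using hm
    rw [relTranslation_box]
    -- The goal is a double negation, so each assumption □C may be replaced by its meet, which is
    -- independent of the current relative formula.
    refine IDerivable.relNN_of_map (Δ := Δ.map fun B => meetTranslation G N (c B) ρ) ?_ ?_
    · intro X hX
      obtain ⟨B, hB, rfl⟩ := List.mem_map.1 hX
      exact .assumption (List.mem_map.2 ⟨B, hs hB, hc' B hB _ _⟩)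
    · refine IDerivable.weaken (.meetTranslation_intro fun F hF => ?_)
        (List.subset_append_left _ _)
      have h' := h (comp ρ (shiftBy N)) hF Term.var
      rw [F.subst_var] at h'
      -- A meet implies its double negation relative to the new `F`, so the boxed assumptions are
      -- recovered there.
      have key : ∀ Δ' : List (MFormula L), Δ' ⊆ Δ → ∀ {X : IFormula L},
          IDerivable Ax (Δ'.map fun C => Epistemic.relTranslation G N C (comp ρ (shiftBy N)) F) X →
          IDerivable Ax ((Δ'.map fun B => meetTranslation G N (c B) ρ).map
            fun C => C.subst (shiftBy N)) X := by
        intro Δ'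
        induction Δ' with
        | nil => exact fun _ _ h => h
        | cons B Δ' ih =>
          intro hs' X hX
          have hB := hs' List.mem_cons_self
          rw [List.map_cons, hc' B hB] at hX
          have := ih (fun _ h => hs' (List.mem_cons_of_mem _ h)) hX.impI
          refine .impE ?_ (this.weaken_cons _)
          rw [List.map_cons, List.map_cons, meetTranslation_subst hG]
          exact .relNN_intro _ .head
      exact key Δ (List.Subset.refl _) h'
  | boxE _ h => exact (h ρ hF τ).relTranslation_bind (IDerivable.head.meetTranslation_elim hG hF τ)
  | botC _ h =>
    -- Since ⊥ is read as `E`, the premise of reductio is precisely a relative double negation of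
    -- the conclusion.
    exact IDerivable.relTranslation_stable (.impI (h ρ hF τ))

/-! ### Recovering an intuitionistic formula from its Gödel translation. -/

/-- The list of all subformulas of a formula. -/
def subformulas : IFormula L → List (IFormula L)
  | .falsum => [.falsum]
  | .equal s t => [.equal s t]
  | .rel R ts => [.rel R ts]
  | .and A B => .and A B :: (subformulas A ++ subformulas B)
  | .or A B => .or A B :: (subformulas A ++ subformulas B)
  | .imp A B => .imp A B :: (subformulas A ++ subformulas B)
  | .all A => .all A :: subformulas A
  | .ex A => .ex A :: subformulas A

theorem mem_subformulas_self (A : IFormula L) : A ∈ subformulas A := by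
  cases A <;> simp [subformulas]

/-- Where the Gödel translation has a □, the meet is instantiated at an instance of a subformula,
which removes the double negation; conversely, an intuitionistic truth does not depend on `E`, so it
gives the whole meet. -/
theorem relTranslation_boxTranslation_iff (hG : ∀ F ∈ G, DependsBelow N F) {A : IFormula L}
    (hA : subformulas A ⊆ G) (ρ : ℕ → L.Term ℕ) (E : IFormula L) {Γ : List (IFormula L)} :
    IDerivable Ax Γ (relTranslation G N A.boxTranslation ρ E) ↔
      IDerivable Ax Γ (relNN E (A.subst ρ)) := by
  have hAG := hA (mem_subformulas_self A)
  induction A generalizing ρ E Γ with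
  | falsum =>
    exact ⟨fun h => .impI (h.weaken_cons _), fun h => .impE (.impI (.botI .head)) h⟩
  | equal s t => exact Iff.rfl
  | rel R ts =>
    refine ⟨fun h => ?_, fun h => ?_⟩
    · refine h.relNN_bind (.relNN_intro _ ?_)
      exact (IDerivable.head.meetTranslation_elim hG hAG ρ).relNN_self
    · refine h.relNN_bind (.relNN_intro _ (.meetTranslation_intro fun F hF => .relNN_intro _ ?_))
      rw [List.map_cons, IFormula.subst_subst]
      exact .head
  | and A B ihA ihB =>
    simp only [subformulas, List.cons_subset, List.append_subset] at hA
    have ihA := @ihA hA.2.1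
    have ihB := @ihB hA.2.2
    refine ⟨fun h => ?_, fun h => .andI ?_ ?_⟩
    · have h₁ := (ihA ρ E (hA.2.1 (mem_subformulas_self A))).1 (.andE₀ h)
      have h₂ := (ihB ρ E (hA.2.2 (mem_subformulas_self B))).1 (.andE₁ h)
      exact h₁.relNN_bind ((h₂.weaken_cons _).relNN_bind
        (.relNN_intro _ (.andI (.assumption (by simp)) .head)))
    · exact (ihA ρ E (hA.2.1 (mem_subformulas_self A))).2
        (h.relNN_bind (.relNN_intro _ (.andE₀ .head)))
    · exact (ihB ρ E (hA.2.2 (mem_subformulas_self B))).2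
        (h.relNN_bind (.relNN_intro _ (.andE₁ .head)))
  | or A B ihA ihB =>
    simp only [subformulas, List.cons_subset, List.append_subset] at hA
    have hA' := hA.2.1 (mem_subformulas_self A)
    have hB' := hA.2.2 (mem_subformulas_self B)
    refine ⟨fun h => h.relNN_bind (.orE .head ?_ ?_), fun h => h.relNN_bind (.orE .head ?_ ?_)⟩
    · exact ((ihA hA.2.1 ρ E hA').1 .head).relNN_bind (.relNN_intro _ (.orI₀ .head))
    · exact ((ihB hA.2.2 ρ E hB').1 .head).relNN_bind (.relNN_intro _ (.orI₁ .head))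
    · exact .relNN_intro _ (.orI₀ ((ihA hA.2.1 ρ E hA').2 (.relNN_intro _ .head)))
    · exact .relNN_intro _ (.orI₁ ((ihB hA.2.2 ρ E hB').2 (.relNN_intro _ .head)))
  | imp A B ihA ihB =>
    simp only [subformulas, List.cons_subset, List.append_subset] at hA
    have hA' := hA.2.1 (mem_subformulas_self A)
    have hB' := hA.2.2 (mem_subformulas_self B)
    refine ⟨fun h => ?_, fun h => ?_⟩
    · refine h.relNN_bind (.relNN_intro _ (.impI ?_))
      -- The relative formula is the consequent itself, whose double negation relative to itself
      -- implies it.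
      refine ((ihB hA.2.2 ρ (B.subst ρ) hB').1 ?_).relNN_self
      refine .impE ((ihA hA.2.1 ρ (B.subst ρ) hA').2 (.relNN_intro _ .head)) ?_
      exact (IDerivable.head.meetTranslation_elim hG hB' ρ).weaken_cons _
    · refine h.relNN_bind (.relNN_intro _ (.meetTranslation_intro fun F hF => .impI ?_))
      refine (ihB hA.2.2 _ F hB').2 (((ihA hA.2.1 _ F hA').1 .head).relNN_bind
        (.relNN_intro _ (.impE .head ?_)))
      rw [List.map_cons, IFormula.subst_subst]
      exact .assumption (by simp [IFormula.subst])
  | all A ih =>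
    simp only [subformulas, List.cons_subset] at hA
    have hA' := hA.2 (mem_subformulas_self A)
    refine ⟨fun h => ?_, fun h => ?_⟩
    · refine h.relNN_bind (.relNN_intro _ (.cut .head (.allI ?_)))
      refine ((ih hA.2 (up ρ) (A.subst (up ρ)) hA').1 ?_).relNN_self
      rw [List.map_cons]
      have := IDerivable.head (Ax := Ax) (Γ := []) (A := (meetTranslation G N
        (A.boxTranslation.all) ρ).subst shift)
      -- Only the conclusion is rewritten, for instantiation at the matrix `A`; its extra variable 0
      -- stays free because `τ` is `up ρ`.
      nth_rw 2 [meetTranslation_subst hG] at this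
      have := IDerivable.allE (Term.var 0) (this.meetTranslation_elim hG hA' (up ρ))
      rw [relTranslation_subst hG, IFormula.subst_shift_inst, up_comp, comp_assoc,
        up_shift_comp_inst_zero, comp_var] at this
      exact this
    · refine h.relNN_bind (.relNN_intro _ (.cut .head (.meetTranslation_intro fun F hF =>
        .allI ((ih hA.2 _ _ hA').2 (.relNN_intro _ ?_)))))
      rw [List.map_cons, List.map_cons, A.all.subst_subst]
      exact .all_shift .head
  | ex A ih =>
    simp only [subformulas, List.cons_subset] at hA
    have hA' := hA.2 (mem_subformulas_self A)
    refine ⟨fun h => h.relNN_bind (.exE .head ?_), fun h => h.relNN_bind (.exE .head ?_)⟩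
    · exact ((ih hA.2 _ _ hA').1 .head).relNN_bind (.relNN_intro _ (.ex_shift .head))
    · exact .relNN_intro _ (.ex_shift ((ih hA.2 _ _ hA').2 (.relNN_intro _ .head)))

/-- Faithfulness of the Gödel translation, relative to axioms whose relative translations are
derivable. -/
theorem IDerivable.of_boxTranslation {AxM : Set (MFormula L)}
    (hAx : ∀ (G : List (IFormula L)) (N : ℕ), (∀ F ∈ G, DependsBelow N F) →
      ∀ B ∈ AxM, ∀ ρ E, IDerivable Ax [] (Epistemic.relTranslation G N B ρ E))
    {A : IFormula L} (h : MDerivable AxM [] A.boxTranslation) : IDerivable Ax [] A := by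
  obtain ⟨N, hN⟩ := exists_dependsBelow_list (subformulas A)
  -- The relative formula is `A` itself, under the identity substitution.
  have := h.relTranslation hN (hAx _ N hN) Term.var (mem_subformulas_self A) Term.var
  rw [List.map_nil, relTranslation_boxTranslation_iff hN (List.Subset.refl _),
    A.subst_var] at this
  exact this.relNN_self

end RelativeTranslation

/-! ### Derived rules of S4, soundness of the translations, and their comparison. -/

section Modal

variable {L : FirstOrder.Language.{u, v}} {Ax : Set (MFormula L)}

theorem MDerivable.weaken {Γ Δ : List (MFormula L)} {A : MFormula L} (h : MDerivable Ax Γ A)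
    (hs : Γ ⊆ Δ) : MDerivable Ax Δ A := by
  induction h generalizing Δ with
  | ax h => exact .ax h
  | assumption h => exact .assumption (hs h)
  | andI _ _ h₁ h₂ => exact .andI (h₁ hs) (h₂ hs)
  | andE₀ _ h => exact .andE₀ (h hs)
  | andE₁ _ h => exact .andE₁ (h hs)
  | orI₀ _ h => exact .orI₀ (h hs)
  | orI₁ _ h => exact .orI₁ (h hs)
  | orE _ _ _ h h₁ h₂ =>
    exact .orE (h hs) (h₁ (List.cons_subset_cons _ hs)) (h₂ (List.cons_subset_cons _ hs))
  | impI _ h => exact .impI (h (List.cons_subset_cons _ hs))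
  | impE _ _ h₁ h₂ => exact .impE (h₁ hs) (h₂ hs)
  | exI t _ h => exact .exI t (h hs)
  | exE _ _ h₁ h₂ => exact .exE (h₁ hs) (h₂ (List.cons_subset_cons _ (List.map_subset _ hs)))
  | allI _ h => exact .allI (h (List.map_subset _ hs))
  | allE t _ h => exact .allE t (h hs)
  | eq t => exact .eq t
  | sub _ _ h₁ h₂ => exact .sub (h₁ hs) (h₂ hs)
  | boxI hΔ hsub h _ => exact .boxI hΔ (List.Subset.trans hsub hs) h
  | boxE _ h => exact .boxE (h hs)
  | botC _ h => exact .botC (h (List.cons_subset_cons _ hs))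

theorem MDerivable.head {Γ : List (MFormula L)} {A : MFormula L} : MDerivable Ax (A :: Γ) A :=
  .assumption List.mem_cons_self

theorem MDerivable.botI {Γ : List (MFormula L)} {A : MFormula L}
    (h : MDerivable Ax Γ MFormula.falsum) : MDerivable Ax Γ A :=
  .botC (h.weaken (List.subset_cons_self _ _))

theorem MDerivable.cut_list {Γ Δ : List (MFormula L)} {A : MFormula L}
    (hΔ : ∀ B ∈ Δ, MDerivable Ax Γ B) (h : MDerivable Ax Δ A) : MDerivable Ax Γ A := by
  induction Δ generalizing A with
  | nil => exact h.weaken (List.nil_subset _)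
  | cons B Δ ih =>
    exact .impE (hΔ B List.mem_cons_self)
      (ih (fun C hC => hΔ C (List.mem_cons_of_mem _ hC)) (.impI h))

theorem MDerivable.cut {Γ : List (MFormula L)} {A B : MFormula L} (hA : MDerivable Ax Γ A)
    (h : MDerivable Ax [A] B) : MDerivable Ax Γ B :=
  cut_list (by simpa using hA) h

/-- The boxed list satisfies the proviso of □I, and □E restores its unboxed members inside. -/
theorem MDerivable.box_of_list {Γ Δ : List (MFormula L)} {A : MFormula L}
    (hΔ : ∀ B ∈ Δ, MDerivable Ax Γ B.box) (h : MDerivable Ax Δ A) : MDerivable Ax Γ A.box := by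
  refine cut_list (Δ := Δ.map MFormula.box) (by simpa using hΔ)
    (.boxI (by simp) (List.Subset.refl _) (cut_list (fun B hB => .boxE (.assumption ?_)) h))
  exact List.mem_map_of_mem hB

theorem MDerivable.box_mono {Γ : List (MFormula L)} {A B : MFormula L}
    (hA : MDerivable Ax Γ A.box) (h : MDerivable Ax [A] B) : MDerivable Ax Γ B.box :=
  box_of_list (by simpa using hA) h

theorem MDerivable.box_nil {Γ : List (MFormula L)} {A : MFormula L} (h : MDerivable Ax [] A) :
    MDerivable Ax Γ A.box :=
  box_of_list (by simp) h

theorem MDerivable.box_box {Γ : List (MFormula L)} {A : MFormula L} (h : MDerivable Ax Γ A.box) :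
    MDerivable Ax Γ A.box.box :=
  h.cut (.boxI (by simp) (List.Subset.refl _) .head)

theorem MFormula.subst_shift_inst_zero (A : MFormula L) :
    (A.subst (up shift)).subst (inst (Term.var 0)) = A := by
  rw [subst_subst, up_shift_comp_inst_zero, subst_var]

theorem MDerivable.all_shift {Γ : List (MFormula L)} {A : MFormula L}
    (h : MDerivable Ax Γ (A.all.subst shift)) : MDerivable Ax Γ A := by
  have := MDerivable.allE (Term.var 0) h
  rwa [A.subst_shift_inst_zero] at this

theorem MDerivable.ex_shift {Γ : List (MFormula L)} {A : MFormula L}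
    (h : MDerivable Ax Γ A) : MDerivable Ax Γ (A.ex.subst shift) :=
  .exI (Term.var 0) (by rwa [A.subst_shift_inst_zero])

theorem MDerivable.all_mono {Γ : List (MFormula L)} {A B : MFormula L}
    (hA : MDerivable Ax Γ A.all) (h : MDerivable Ax [A] B) : MDerivable Ax Γ B.all :=
  hA.cut (.allI (.cut (.all_shift .head) h))

theorem MDerivable.box_all_box {Γ : List (MFormula L)} {A : MFormula L}
    (h : MDerivable Ax Γ A.all.box) : MDerivable Ax Γ A.box.all.box :=
  h.box_box.box_mono (.allI (box_mono .head (.all_shift .head)))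

/-- Necessity of identity: replace `s` by `t` on the right of □(s = s). Hence equations need no □ in
the translations. -/
theorem MDerivable.equal_box {Γ : List (MFormula L)} {s t : L.Term ℕ}
    (h : MDerivable Ax Γ (.equal s t)) : MDerivable Ax Γ (MFormula.equal s t).box := by
  have key (r : L.Term ℕ) : (MFormula.box (.equal (s.subst shift) (Term.var 0))).subst (inst r) =
      (MFormula.equal s r).box := by
    simp only [MFormula.subst, Term.subst_subst, shift_comp_inst, Term.subst_var]
    rfl
  rw [← key t]
  refine .sub h ?_
  rw [key s]
  exact .box_nil (.eq s)

theorem IFormula.toModal_subst (A : IFormula L) (σ : ℕ → L.Term ℕ) :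
    (A.subst σ).toModal = A.toModal.subst σ := by
  induction A generalizing σ <;> simp_all [subst, toModal, MFormula.subst]

theorem IFormula.boxTranslation_subst (A : IFormula L) (σ : ℕ → L.Term ℕ) :
    (A.subst σ).boxTranslation = A.boxTranslation.subst σ := by
  induction A generalizing σ <;> simp_all [subst, boxTranslation, MFormula.subst]

theorem IDerivable.toModal {AxI : Set (IFormula L)} (hAx : ∀ A ∈ AxI, MDerivable Ax [] A.toModal)
    {Γ : List (IFormula L)} {A : IFormula L} (h : IDerivable AxI Γ A) :
    MDerivable Ax (Γ.map IFormula.toModal) A.toModal := by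
  have hshift (Γ : List (IFormula L)) : (Γ.map fun C => C.subst shift).map IFormula.toModal =
      (Γ.map IFormula.toModal).map fun C => C.subst shift := by
    simp [IFormula.toModal_subst]
  induction h with
  | ax h => exact (hAx _ h).weaken (List.nil_subset _)
  | assumption h => exact .assumption (List.mem_map_of_mem h)
  | andI _ _ h₁ h₂ => exact .andI h₁ h₂
  | andE₀ _ h => exact .andE₀ h
  | andE₁ _ h => exact .andE₁ h
  | orI₀ _ h => exact .orI₀ h
  | orI₁ _ h => exact .orI₁ h
  | orE _ _ _ h h₁ h₂ => exact .orE h h₁ h₂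
  | impI _ h => exact .impI h
  | impE _ _ h₁ h₂ => exact .impE h₁ h₂
  | botI _ h => exact .botI h
  | exI t _ h => exact .exI t (by rwa [← IFormula.toModal_subst])
  | exE _ _ h₁ h₂ =>
    rw [List.map_cons, hshift, IFormula.toModal_subst] at h₂
    exact .exE h₁ h₂
  | allI _ h => exact .allI (by rwa [← hshift])
  | allE t _ h =>
    rw [IFormula.toModal_subst]
    exact .allE t h
  | eq t => exact .eq t
  | sub _ _ h₁ h₂ =>
    rw [IFormula.toModal_subst] at h₂ ⊢
    exact .sub h₁ h₂

/-- Boxed clauses use □A ⊢ □□A, equations the necessity of identity, and ∧, ∨, ∃ pass the □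
outwards. -/
theorem MDerivable.boxTranslation_stable {Γ : List (MFormula L)} {A : IFormula L}
    (h : MDerivable Ax Γ A.boxTranslation) : MDerivable Ax Γ A.boxTranslation.box := by
  induction A generalizing Γ with
  | falsum => exact .botI h
  | equal s t => exact h.equal_box
  | rel R ts | imp A B hA hB | all A hA => exact h.box_box
  | and A B hA hB =>
    refine box_of_list (Δ := [A.boxTranslation, B.boxTranslation]) ?_
      (.andI .head (.assumption (by simp)))
    simpa using ⟨hA (.andE₀ h), hB (.andE₁ h)⟩
  | or A B hA hB =>
    exact .orE h ((hA .head).box_mono (.orI₀ .head)) ((hB .head).box_mono (.orI₁ .head))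
  | ex A hA => exact .exE h ((hA .head).box_mono (.ex_shift .head))

theorem MDerivable.box_of_stable {Γ : List (IFormula L)} {A : MFormula L}
    (h : MDerivable Ax (Γ.map IFormula.boxTranslation) A) :
    MDerivable Ax (Γ.map IFormula.boxTranslation) A.box := by
  refine box_of_list (fun B hB => ?_) h
  obtain ⟨C, -, rfl⟩ := List.mem_map.1 hB
  exact .boxTranslation_stable (.assumption hB)

theorem IDerivable.boxTranslation {AxI : Set (IFormula L)}
    (hAx : ∀ A ∈ AxI, MDerivable Ax [] A.boxTranslation)
    {Γ : List (IFormula L)} {A : IFormula L} (h : IDerivable AxI Γ A) :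
    MDerivable Ax (Γ.map IFormula.boxTranslation) A.boxTranslation := by
  have hshift (Γ : List (IFormula L)) :
      (Γ.map fun C => C.subst shift).map IFormula.boxTranslation =
        (Γ.map IFormula.boxTranslation).map fun C => C.subst shift := by
    simp [IFormula.boxTranslation_subst]
  induction h with
  | ax h => exact (hAx _ h).weaken (List.nil_subset _)
  | assumption h => exact .assumption (List.mem_map_of_mem h)
  | andI _ _ h₁ h₂ => exact .andI h₁ h₂
  | andE₀ _ h => exact .andE₀ h
  | andE₁ _ h => exact .andE₁ h
  | orI₀ _ h => exact .orI₀ h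
  | orI₁ _ h => exact .orI₁ h
  | orE _ _ _ h h₁ h₂ => exact .orE h h₁ h₂
  | impI _ h => exact MDerivable.box_of_stable (.impI h)
  | impE _ _ h₁ h₂ => exact .impE h₁ (.boxE h₂)
  | botI _ h => exact .botI h
  | exI t _ h => exact .exI t (by rwa [← IFormula.boxTranslation_subst])
  | exE _ _ h₁ h₂ =>
    rw [List.map_cons, hshift, IFormula.boxTranslation_subst] at h₂
    exact .exE h₁ h₂
  | allI _ h => exact MDerivable.box_of_stable (.allI (by rwa [← hshift]))
  | allE t _ h =>
    rw [IFormula.boxTranslation_subst]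
    exact .allE t (.boxE h)
  | eq t => exact .eq t
  | sub _ _ h₁ h₂ =>
    rw [IFormula.boxTranslation_subst] at h₂ ⊢
    exact .sub h₁ h₂

/-- `□` of the modified translation is equivalent to the Gödel translation. -/
theorem MDerivable.box_rsTranslation_iff {Γ : List (MFormula L)} {A : IFormula L} :
    MDerivable Ax Γ A.rsTranslation.box ↔ MDerivable Ax Γ A.boxTranslation := by
  induction A generalizing Γ with
  | falsum => exact ⟨.boxE, .botI⟩
  | equal s t => exact ⟨.boxE, .equal_box⟩
  | rel R ts => exact ⟨.boxE, .box_box⟩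
  | and A B hA hB =>
    refine ⟨fun h => .andI (hA.1 (h.box_mono (.andE₀ .head))) (hB.1 (h.box_mono (.andE₁ .head))),
      fun h => box_of_list (Δ := [A.rsTranslation, B.rsTranslation]) ?_
        (.andI .head (.assumption (by simp)))⟩
    simpa using ⟨hA.2 (.andE₀ h), hB.2 (.andE₁ h)⟩
  | or A B hA hB =>
    exact ⟨fun h => .orE (.boxE h) (.orI₀ (hA.1 .head)) (.orI₁ (hB.1 .head)),
      fun h => .orE h ((hA.2 .head).box_box.box_mono (.orI₀ .head))
        ((hB.2 .head).box_box.box_mono (.orI₁ .head))⟩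
  | imp A B hA hB =>
    refine ⟨fun h => (MDerivable.boxE h).box_mono (.impI (hB.1 (.impE (hA.2 .head) ?_))),
      fun h => (h.box_mono (.impI (hB.2 (.impE (hA.1 .head) ?_)))).box_box⟩
    all_goals exact .assumption (by simp)
  | all A hA =>
    exact ⟨fun h => h.box_box.box_mono (.allI (hA.1 (box_mono .head (.all_shift .head)))),
      fun h => h.box_mono (.allI (.boxE (hA.2 (.all_shift .head))))⟩
  | ex A hA =>
    exact ⟨fun h => .exE (.boxE h) (.ex_shift (hA.1 .head)),
      fun h => .exE h ((hA.2 .head).box_box.box_mono (.ex_shift .head))⟩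

/-- Without open assumptions, necessitation and □E add and remove the outer □ freely. -/
theorem MDerivable.rsTranslation_iff {A : IFormula L} :
    MDerivable Ax [] A.rsTranslation ↔ MDerivable Ax [] A.boxTranslation :=
  ⟨fun h => box_rsTranslation_iff.1 h.box_nil, fun h => .boxE (box_rsTranslation_iff.2 h)⟩

end Modal

/-! ### The axioms of arithmetic under both translations. -/

section Arithmetic

open Arith

theorem IDerivable.all_mono {L : FirstOrder.Language.{u, v}} {Ax : Set (IFormula L)}
    {Γ : List (IFormula L)} {A B : IFormula L}
    (hA : IDerivable Ax Γ A.all) (h : IDerivable Ax [A] B) : IDerivable Ax Γ B.all :=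
  hA.cut (.allI (.cut (.all_shift .head) h))

theorem Arith.zero_subst (σ : ℕ → arith.Term ℕ) : zero.subst σ = zero := by
  simp only [zero, Term.subst]
  congr 1
  exact funext fun i => i.elim0

theorem Arith.succ_subst (t : arith.Term ℕ) (σ : ℕ → arith.Term ℕ) :
    (succ t).subst σ = succ (t.subst σ) := by
  simp only [succ, Term.subst]
  congr 1
  funext i
  fin_cases i
  rfl

theorem Arith.add_subst (s t : arith.Term ℕ) (σ : ℕ → arith.Term ℕ) :
    (add s t).subst σ = add (s.subst σ) (t.subst σ) := by
  simp only [add, Term.subst]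
  congr 1
  funext i
  fin_cases i <;> rfl

theorem Arith.mul_subst (s t : arith.Term ℕ) (σ : ℕ → arith.Term ℕ) :
    (mul s t).subst σ = mul (s.subst σ) (t.subst σ) := by
  simp only [mul, Term.subst]
  congr 1
  funext i
  fin_cases i <;> rfl

theorem Arith.x_zero_subst_up (σ : ℕ → arith.Term ℕ) : (x 0).subst (up σ) = x 0 := rfl

theorem Arith.x_one_subst_up_up (σ : ℕ → arith.Term ℕ) : (x 1).subst (up (up σ)) = x 1 := rfl

/-- `succSubst` changes only variable 0, which `up σ` fixes and which does not occur in its other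
values. -/
theorem Arith.succSubst_comp_up (σ : ℕ → arith.Term ℕ) :
    comp succSubst (up σ) = comp (up σ) succSubst := by
  funext n
  cases n with
  | zero => exact succ_subst _ _
  | succ n =>
    show up σ (n + 1) = (up σ (n + 1)).subst succSubst
    rw [up_succ, Term.subst_subst]
    rfl

theorem HAAxiom.toModal {A : IFormula arith} (h : HAAxiom A) : EAAxiom A.toModal := by
  cases h with
  | succ_ne_zero => exact .succ_ne_zero
  | succ_inj => exact .succ_inj
  | add_zero => exact .add_zero
  | add_succ => exact .add_succ
  | mul_zero => exact .mul_zero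
  | mul_succ => exact .mul_succ
  | induction A =>
    simp only [IFormula.toModal, IFormula.toModal_subst]
    exact .induction _

theorem HAAxiom.boxTranslation {A : IFormula arith} (h : HAAxiom A) :
    MDerivable {B | EAAxiom B} [] A.boxTranslation := by
  have ax {B : MFormula arith} (h : EAAxiom B) : MDerivable {B | EAAxiom B} [] B.box :=
    .box_nil (.ax h)
  have ax₂ {B : MFormula arith} (h : EAAxiom B.all.all) :
      MDerivable {B | EAAxiom B} [] B.all.box.all.box :=
    (ax h).box_all_box
  cases h with
  | succ_ne_zero => exact (ax .succ_ne_zero).box_all_box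
  | succ_inj => exact (ax₂ .succ_inj).box_mono (.all_mono .head (.box_all_box .head))
  | add_zero => exact ax .add_zero
  | add_succ => exact ax₂ .add_succ
  | mul_zero => exact ax .mul_zero
  | mul_succ => exact ax₂ .mul_succ
  | induction A =>
    -- The induction hypothesis is itself a translation, hence stable, so the conclusion of
    -- induction for `A.boxTranslation` can be boxed.
    refine .box_nil (.impI (MDerivable.box_of_stable (Γ := [.and (A.subst (inst zero))
      (.all (.imp A (A.subst succSubst)))]) (.impE ?_ (.ax (.induction A.boxTranslation)))))
    rw [← IFormula.boxTranslation_subst, ← IFormula.boxTranslation_subst]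
    exact .andI (.andE₀ .head) (.all_mono (.boxE (.andE₁ .head)) (.boxE .head))

theorem EAAxiom.relTranslation {G : List (IFormula arith)} {N : ℕ}
    (hG : ∀ F ∈ G, DependsBelow N F) {A : MFormula arith} (h : EAAxiom A) (ρ : ℕ → arith.Term ℕ)
    (E : IFormula arith) :
    IDerivable {B | HAAxiom B} [] (Epistemic.relTranslation G N A ρ E) := by
  cases h with
  | induction A =>
    -- The reading commutes with ∧, ⊃ and ∀, so modal induction becomes Heyting induction for the
    -- translated formula.
    refine .impI (.impE ?_ (.ax (.induction (Epistemic.relTranslation G N A (up ρ)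
      (E.subst shift)))))
    have h₀ := relTranslation_up_inst hG A ρ E zero
    rw [zero_subst] at h₀
    rw [h₀, relTranslation_subst hG, ← succSubst_comp_up, ← relTranslation_subst_left,
      IFormula.subst_subst]
    exact .head
  | _ =>
    simp only [Epistemic.relTranslation, MFormula.neg, zero_subst, succ_subst, add_subst,
      mul_subst, x_zero_subst_up, x_one_subst_up_up]
    first
    | exact .all_mono (.ax .succ_inj) (.all_mono .head (.impI (.relNN_bind .head
        (.relNN_intro _ (.impE .head (.assumption (by simp)))))))
    | exact .all_mono (.ax .add_zero) (.relNN_intro _ .head)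
    | exact .all_mono (.ax .add_succ) (.all_mono .head (.relNN_intro _ .head))
    | exact .all_mono (.ax .mul_zero) (.relNN_intro _ .head)
    | exact .all_mono (.ax .mul_succ) (.all_mono .head (.relNN_intro _ .head))
    | exact .all_mono (.ax .succ_ne_zero) (.impI (.impE (.impI (.botI (.impE .head
        (.assumption (by simp [IFormula.neg]))))) .head))

end Arithmetic

end Epistemic

theorem corollary2p2 :
    (∀ (L : FirstOrder.Language.{u, v}) (A : Epistemic.IFormula L),
      (Epistemic.IQC A → Epistemic.EQC A.toModal) ∧
      (Epistemic.IQC A ↔ Epistemic.EQC A.rsTranslation) ∧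
      (Epistemic.IQC A ↔ Epistemic.EQC A.boxTranslation)) ∧
    (∀ A : Epistemic.IFormula Epistemic.arith,
      (Epistemic.HA A → Epistemic.EA A.toModal) ∧
      (Epistemic.HA A ↔ Epistemic.EA A.rsTranslation) ∧
      (Epistemic.HA A ↔ Epistemic.EA A.boxTranslation)) := by
  refine ⟨fun L A => ?_, fun A => ?_⟩
  · have h : Epistemic.IQC A ↔ Epistemic.EQC A.boxTranslation :=
      ⟨fun h => h.boxTranslation (by simp), .of_boxTranslation (by simp)⟩
    exact ⟨fun h => h.toModal (by simp), h.trans Epistemic.MDerivable.rsTranslation_iff.symm, h⟩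
  · have h : Epistemic.HA A ↔ Epistemic.EA A.boxTranslation :=
      ⟨fun h => h.boxTranslation fun _ hB => hB.boxTranslation,
        .of_boxTranslation fun _ _ hG _ hB => hB.relTranslation hG⟩
    exact ⟨fun h => h.toModal fun _ hB => .ax hB.toModal,
      h.trans Epistemic.MDerivable.rsTranslation_iff.symm, h⟩
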